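/- Let $(\mathscr W,\otimes,I)$ be a monoidal category such that (1) $\mathscr W$ is locally finitely presentable, (2) $I$ is finitely presentable, and $A\otimes B$ is finitely presentable whenever $A$ and $B$ are, (3) for every object $W$ the functor ${-}\otimes W$ preserves finite coproducts, (4) $\otimes$ preserves filtered colimits in both variables. (The structural isomorphisms of $\otimes$ are suppressed in the notation below.) Let $H\colon\mathscr W\to\mathscr W$ preserve filtered colimits and be equipped with a *point-strength*: a family of morphisms $s_{(X,x),(Y,y)}\colon HX\otimes Y\to H(X\otimes Y)$, natural in the objects $x\colon I\to X$ and $y\colon I\to Y$ of the slice category $I/\mathscr W$, with $s_{(X,x),(I,\mathrm{id})}=\mathrm{id}_{HX}$ and $$s_{(X,x),(Y\otimes Z,\,y\otimes z)}=s_{(X\otimes Y,\,x\otimes y),(Z,z)}\cdot(s_{(X,x),(Y,y)}\otimes Z).$$ An $H$-algebra $a\colon HA\to A$ is *iterative* if for every finitely presentable $X$ and every $e\colon X\to HX+A$ there is a unique $e^\dagger\colon X\to A$ with $e^\dagger=[a,\mathrm{id}_A]\cdot(He^\dagger+\mathrm{id}_A)\cdot e$. A *free iterative $H$-algebra* on $Y$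 is an iterative algebra $\varrho_Y\colon HRY\to RY$ with a morphism $\eta_Y\colon Y\to RY$ such that every morphism from $Y$ to an iterative algebra factorizes through $\eta_Y$ by a unique $H$-algebra homomorphism from $RY$. Then a free iterative $H$-algebra exists on every object $Y$. Fix a choice of these, and let $(R,\eta,\mu)$ be the resulting monad (the rational monad), where $\mu_Y\colon RRY\to RY$ is the unique $H$-algebra homomorphism with $\mu_Y\cdot\eta_{RY}=\mathrm{id}$. There is a unique family $s^R_{(X,x),(Y,y)}\colon RX\otimes Y\to R(X\otimes Y)$, natural in $(X,x)$ and $(Y,y)$, with $$s^R_{(X,x),(Y,y)}\cdot(\varrho_X\otimes Y)=\varrho_{X\otimes Y}\cdot Hs^R_{(X,x),(Y,y)}\cdot s_{(RX,\eta_X\cdot x),(Y,y)},\qquad s^R_{(X,x),(Y,y)}\cdot(\eta_X\otimes Y)=\eta_{X\otimes Y};$$ it is a point-strength of $R$ and satisfies $s^R_{(X,x),(Y,y)}\cdot(\mu_X\otimes Y)=\mu_{X\otimes Y}\cdot Rs^R_{(X,x),(Y,y)}\cdot s^R_{(RX,\eta_X\cdot x),(Y,y)}$. Finally, the free iterative algebra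 $RI$ with $$i=\eta_I\colon I\to RI,\qquad m=\mu_I\cdot s^R_{(I,\mathrm{id}),(RI,\eta_I)}\colon RI\otimes RI\to RI$$ is an $H$-monoid: $(RI,m,i)$ is a monoid in $\mathscr W$ (the two unit laws and associativity hold), and $$m\cdot(\varrho_I\otimes RI)=\varrho_I\cdot Hm\cdot s_{(RI,i),(RI,i)}.$$ -/

import Mathlib

open CategoryTheory MonoidalCategory Limits

universe v u

/-- Monoidally locally finitely presentable categories. Strictness of the monoidal structure is
not required; a strict monoidal category is the case of trivial structural isomorphisms. -/
class MonoidallyLFP (C : Type u) [Category.{v} C] [MonoidalCategory C] : Prop where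
  locallyFinitelyPresentable : IsLocallyFinitelyPresentable.{v} C
  unit_finitelyPresentable : IsFinitelyPresentable.{v} (𝟙_ C)
  tensor_finitelyPresentable : ∀ X Y : C, IsFinitelyPresentable.{v} X →
    IsFinitelyPresentable.{v} Y → IsFinitelyPresentable.{v} (X ⊗ Y)
  /-- right distributivity: every functor `- ⊗ W` preserves finite coproducts -/
  right_distributive : ∀ W : C, PreservesFiniteCoproducts (tensorRight W)
  finitary_left_variable : ∀ W : C, PreservesFilteredColimits (tensorRight W)
  finitary_right_variable : ∀ W : C, PreservesFilteredColimits (tensorLeft W)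

instance MonoidallyLFP.hasBinaryCoproducts (C : Type u) [Category.{v} C] [MonoidalCategory C]
    [h : MonoidallyLFP C] : HasBinaryCoproducts C :=
  haveI := h.locallyFinitelyPresentable
  haveI : HasColimitsOfSize.{v, v} C := this.toHasColimitsOfSize
  inferInstance

section Iterative

variable {C : Type u} [Category.{v} C] [HasBinaryCoproducts C] {H : C ⥤ C}

/-- `s : X ⟶ A` solves the flat equation morphism `e : X ⟶ H X + A` in the algebra `A`. -/
def IsSolution (A : Endofunctor.Algebra H) {X : C} (e : X ⟶ H.obj X ⨿ A.a) (s : X ⟶ A.a) :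
    Prop :=
  s = e ≫ coprod.map (H.map s) (𝟙 A.a) ≫ coprod.desc A.str (𝟙 A.a)

/-- Every flat equation morphism with a finitely presentable object of variables has a
unique solution in `A`. -/
def IsIterative (A : Endofunctor.Algebra H) : Prop :=
  ∀ (X : C), IsFinitelyPresentable.{v} X → ∀ e : X ⟶ H.obj X ⨿ A.a, ∃! s, IsSolution A e s

variable (H) in
/-- A free iterative `H`-algebra on the object `Y`, with its universal arrow `η`. -/
structure FreeIterativeAlgebra (Y : C) where
  alg : Endofunctor.Algebra H
  iterative : IsIterative alg
  η : Y ⟶ alg.a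
  universal : ∀ B : Endofunctor.Algebra H, IsIterative B → ∀ f : Y ⟶ B.a,
    ∃! h : alg ⟶ B, η ≫ h.f = f

namespace FreeIterativeAlgebra

/-- The unique homomorphism extending `f`. -/
noncomputable def extend {Y : C} (A : FreeIterativeAlgebra H Y) (B : Endofunctor.Algebra H)
    (hB : IsIterative B) (f : Y ⟶ B.a) : A.alg ⟶ B :=
  (A.universal B hB f).choose

theorem η_extend {Y : C} (A : FreeIterativeAlgebra H Y) (B : Endofunctor.Algebra H)
    (hB : IsIterative B) (f : Y ⟶ B.a) : A.η ≫ (A.extend B hB f).f = f :=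
  (A.universal B hB f).choose_spec.1

theorem hom_ext {Y : C} (A : FreeIterativeAlgebra H Y) (B : Endofunctor.Algebra H)
    (hB : IsIterative B) {g h : A.alg ⟶ B} (w : A.η ≫ g.f = A.η ≫ h.f) : g.f = h.f := by
  rw [(A.universal B hB (A.η ≫ h.f)).unique w rfl]

end FreeIterativeAlgebra

/-- The functor part of the rational monad, for a choice `R Y` of free iterative algebras. -/
@[simps]
noncomputable def rationalFunctor (R : ∀ Y : C, FreeIterativeAlgebra H Y) : C ⥤ C where
  obj Y := (R Y).alg.a
  map {X Y} f := ((R X).extend (R Y).alg (R Y).iterative (f ≫ (R Y).η)).f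
  map_id X := by
    refine (R X).hom_ext (h := 𝟙 (R X).alg) _ (R X).iterative ?_
    simp [FreeIterativeAlgebra.η_extend]
  map_comp {X Y Z} f g := by
    refine (R X).hom_ext (h := (R X).extend (R Y).alg (R Y).iterative (f ≫ (R Y).η) ≫
      (R Y).extend (R Z).alg (R Z).iterative (g ≫ (R Z).η)) _ (R Z).iterative ?_
    rw [FreeIterativeAlgebra.η_extend, Endofunctor.Algebra.comp_f, ← Category.assoc (R X).η,
      FreeIterativeAlgebra.η_extend, Category.assoc f, Category.assoc f, FreeIterativeAlgebra.η_extend]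

/-- The rational monad: `μ_Y : R R Y ⟶ R Y` is the unique homomorphism extending the identity
of `R Y`. -/
noncomputable def rationalMonad (R : ∀ Y : C, FreeIterativeAlgebra H Y) : Monad C where
  toFunctor := rationalFunctor R
  η :=
    { app := fun Y => (R Y).η
      naturality := fun X Y f => ((R X).η_extend _ (R Y).iterative _).symm }
  μ :=
    { app := fun Y =>
        ((R (R Y).alg.a).extend (R Y).alg (R Y).iterative (𝟙 (R Y).alg.a)).f
      naturality := fun X Y f => by
        refine (R (R X).alg.a).hom_ext
          (g := (R (R X).alg.a).extend (R (R Y).alg.a).alg (R (R Y).alg.a).iterative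
              (((R X).extend (R Y).alg (R Y).iterative (f ≫ (R Y).η)).f ≫ (R (R Y).alg.a).η) ≫
            (R (R Y).alg.a).extend (R Y).alg (R Y).iterative (𝟙 _))
          (h := (R (R X).alg.a).extend (R X).alg (R X).iterative (𝟙 _) ≫
            (R X).extend (R Y).alg (R Y).iterative (f ≫ (R Y).η)) _ (R Y).iterative ?_
        rw [Endofunctor.Algebra.comp_f, Endofunctor.Algebra.comp_f, ← Category.assoc,
          FreeIterativeAlgebra.η_extend, Category.assoc, FreeIterativeAlgebra.η_extend,
          ← Category.assoc, FreeIterativeAlgebra.η_extend, Category.comp_id, Category.id_comp] }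
  assoc Y := by
    refine (R (R (R Y).alg.a).alg.a).hom_ext
      (g := (R (R (R Y).alg.a).alg.a).extend (R (R Y).alg.a).alg (R (R Y).alg.a).iterative
          (((R (R Y).alg.a).extend (R Y).alg (R Y).iterative (𝟙 _)).f ≫ (R (R Y).alg.a).η) ≫
        (R (R Y).alg.a).extend (R Y).alg (R Y).iterative (𝟙 _))
      (h := (R (R (R Y).alg.a).alg.a).extend (R (R Y).alg.a).alg (R (R Y).alg.a).iterative (𝟙 _) ≫
        (R (R Y).alg.a).extend (R Y).alg (R Y).iterative (𝟙 _)) _ (R Y).iterative ?_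
    rw [Endofunctor.Algebra.comp_f, Endofunctor.Algebra.comp_f, ← Category.assoc,
      FreeIterativeAlgebra.η_extend, Category.assoc, FreeIterativeAlgebra.η_extend,
      ← Category.assoc, FreeIterativeAlgebra.η_extend, Category.comp_id, Category.id_comp]
  left_unit Y := (R (R Y).alg.a).η_extend _ (R Y).iterative _
  right_unit Y := by
    refine (R Y).hom_ext
      (g := (R Y).extend (R (R Y).alg.a).alg (R (R Y).alg.a).iterative
          ((R Y).η ≫ (R (R Y).alg.a).η) ≫
        (R (R Y).alg.a).extend (R Y).alg (R Y).iterative (𝟙 _))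
      (h := 𝟙 (R Y).alg) _ (R Y).iterative ?_
    rw [Endofunctor.Algebra.comp_f, ← Category.assoc, FreeIterativeAlgebra.η_extend,
      Category.assoc, FreeIterativeAlgebra.η_extend]
    rfl

end Iterative

section PointStrength

variable {C : Type u} [Category.{v} C] [MonoidalCategory C]

/-- An object `X` with a point `x : I ⟶ X`, as an object of the slice category `I / C`. -/
abbrev pointed {X : C} (x : 𝟙_ C ⟶ X) : Under (𝟙_ C) := Under.mk x

/-- `(X ⊗ Y, x ⊗ y)`. -/
abbrev pointedTensor (X Y : Under (𝟙_ C)) : Under (𝟙_ C) :=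
  pointed (X := X.right ⊗ Y.right) ((λ_ (𝟙_ C)).inv ≫ (X.hom ⊗ₘ Y.hom))

/-- A family `F X ⊗ Y ⟶ F (X ⊗ Y)` natural in the pointed objects `(X, x)` and `(Y, y)`. -/
structure PointedFamily (F : C ⥤ C) where
  app : ∀ X Y : Under (𝟙_ C), F.obj X.right ⊗ Y.right ⟶ F.obj (X.right ⊗ Y.right)
  naturality : ∀ {X X' Y Y' : Under (𝟙_ C)} (f : X ⟶ X') (g : Y ⟶ Y'),
    (F.map f.right ⊗ₘ g.right) ≫ app X' Y' = app X Y ≫ F.map (f.right ⊗ₘ g.right)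

/-- A point-strength of an endofunctor. -/
structure PointStrength (F : C ⥤ C) extends PointedFamily F where
  unit : ∀ X : Under (𝟙_ C),
    app X (pointed (𝟙 (𝟙_ C))) ≫ F.map (ρ_ X.right).hom = (ρ_ (F.obj X.right)).hom
  tensor : ∀ X Y Z : Under (𝟙_ C),
    (α_ (F.obj X.right) Y.right Z.right).hom ≫ app X (pointedTensor Y Z) =
      (app X Y ▷ Z.right) ≫ app (pointedTensor X Y) Z ≫
        F.map (α_ X.right Y.right Z.right).hom

/-- The point-strength `s` of the functor part of the monad `M` is compatible with the unit and
the multiplication, so that `M` with `s` is a point-strong monad. -/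
structure IsPointStrongMonad (M : Monad C) (s : PointStrength M.toFunctor) : Prop where
  unit : ∀ X Y : Under (𝟙_ C),
    (M.η.app X.right ▷ Y.right) ≫ s.app X Y = M.η.app (X.right ⊗ Y.right)
  mul : ∀ X Y : Under (𝟙_ C),
    (M.μ.app X.right ▷ Y.right) ≫ s.app X Y =
      s.app (pointed (X.hom ≫ M.η.app X.right)) Y ≫ M.map (s.app X Y) ≫
        M.μ.app (X.right ⊗ Y.right)

/-- An `H`-algebra `A` whose carrier is a monoid is an `H`-monoid if multiplication is compatible
with the algebra structure through the point-strength. -/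
def IsHMonoid {H : C ⥤ C} (s : PointStrength H) (A : Endofunctor.Algebra H) (M : MonObj A.a) :
    Prop :=
  (A.str ▷ A.a) ≫ M.mul = s.app (pointed M.one) (pointed M.one) ≫ H.map M.mul ≫ A.str

/-- The diagram relating a family `t : R X ⊗ Y ⟶ R (X ⊗ Y)` to the point-strength of `H`, to
the algebra structures `H (R X) ⟶ R X` and to the universal arrows `X ⟶ R X`. -/
structure IsRationalStrength [HasBinaryCoproducts C] {H : C ⥤ C} (s : PointStrength H)
    (R : ∀ Y : C, FreeIterativeAlgebra H Y) (t : PointedFamily (rationalFunctor R)) : Prop where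
  str : ∀ X Y : Under (𝟙_ C),
    ((R X.right).alg.str ▷ Y.right) ≫ t.app X Y =
      s.app (pointed (X.hom ≫ (R X.right).η)) Y ≫ H.map (t.app X Y) ≫
        (R (X.right ⊗ Y.right)).alg.str
  η : ∀ X Y : Under (𝟙_ C),
    ((R X.right).η ▷ Y.right) ≫ t.app X Y = (R (X.right ⊗ Y.right)).η

end PointStrength

-- The free iterative algebra on `Y` is the colimit of all coalgebras for `H (-) + Y` with finitely
-- presentable carrier. These form an essentially small filtered category, and the colimit is again
-- a coalgebra, whose structure is invertible (`rationalStr_isIso`). Hence it splits into an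
-- `H`-algebra structure and a unit. Each finitely presentable coalgebra has exactly one
-- homomorphism into it (`FPCoalgebra.eq_inj`), which gives iterativity: an equation, merged with a
-- coalgebra supplying its parameters, is again a finitely presentable coalgebra. Freeness holds
-- because a homomorphic extension of `f` is a solution of an equation that is a colimit of
-- equations with finitely presentable variables, and unique solvability passes to colimits
-- (`existsUnique_solution_of_colimit`).
--
-- The same colimit argument proves recursion with a parameter (`existsUnique_strength_lift`): for
-- an iterative `A`, a morphism `X ⊗ Y ⟶ A` extends uniquely to a morphism `R X ⊗ Y ⟶ A` that is a
-- homomorphism in the first variable up to `s`. Distributivity turns such extensions into solutions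
-- of an equation on `R X ⊗ Y`, which is a colimit of equations on `W ⊗ Y'` with `W` and `Y'`
-- finitely presentable. Since `s` is natural only in pointed objects, the diagrams are restricted
-- to stages through which the points factor; finite presentability of `I` makes these cofinal.
--
-- Everything else is uniqueness: both sides of each strength, monad or monoid law are parametrized
-- homomorphisms that agree on generators (`parametrizedHom_ext`).

attribute [local instance] Cardinal.fact_isRegular_aleph0
attribute [local simp] coprod.inl_desc coprod.inr_desc coprod.inl_desc_assoc coprod.inr_desc_assoc

/-! ### Finitely presentable objects and connected colimits -/

section Presentability

variable {C : Type u} [Category.{v} C]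

theorem IsFinitelyPresentable.coprod [HasBinaryCoproducts C] {X Y : C}
    (hX : IsFinitelyPresentable.{v} X) (hY : IsFinitelyPresentable.{v} Y) :
    IsFinitelyPresentable.{v} (X ⨿ Y) := by
  have : ∀ k, IsCardinalPresentable.{v} ((pair X Y).obj k) Cardinal.aleph0 := by
    rintro ⟨_ | _⟩ <;> assumption
  exact isCardinalPresentable_of_isColimit.{v} (colimit.cocone (pair X Y)) (colimit.isColimit _) _
    (by rw [hasCardinalLT_aleph0_iff]; infer_instance)

theorem IsFinitelyPresentable.coequalizer [HasCoequalizers C] {X Y : C} (f g : X ⟶ Y)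
    (hX : IsFinitelyPresentable.{v} X) (hY : IsFinitelyPresentable.{v} Y) :
    IsFinitelyPresentable.{v} (coequalizer f g) := by
  have : ∀ k, IsCardinalPresentable.{v} ((parallelPair f g).obj k) Cardinal.aleph0 := by
    rintro (_ | _) <;> assumption
  exact isCardinalPresentable_of_isColimit.{v} (colimit.cocone (parallelPair f g))
    (colimit.isColimit _) _ (by rw [hasCardinalLT_aleph0_iff]; infer_instance)

theorem exists_filtered_presentation [IsLocallyFinitelyPresentable.{v} C] (X : C) :
    ∃ (J : Type v) (_ : SmallCategory J) (_ : IsFiltered J) (D : J ⥤ C) (c : Cocone D)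
      (_ : IsColimit c), c.pt = X ∧ ∀ j, IsFinitelyPresentable.{v} (D.obj j) := by
  obtain ⟨P, _, hP⟩ := HasCardinalFilteredGenerator.exists_generator C Cardinal.aleph0.{v}
  obtain ⟨J, _, hJ, ⟨p⟩⟩ := hP.exists_colimitsOfShape X
  exact ⟨J, _, (isCardinalFiltered_aleph0_iff J).1 hJ, p.diag, _, p.isColimit, rfl,
    fun j => hP.le_isCardinalPresentable _ (p.prop_diag_obj j)⟩

theorem CategoryTheory.Limits.IsColimit.existsUnique_desc {J : Type*} [Category* J] {F : J ⥤ C}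
    {c : Cocone F} (hc : IsColimit c) {Z : C} (t : ∀ j, F.obj j ⟶ Z)
    (ht : ∀ {j k : J} (u : j ⟶ k), F.map u ≫ t k = t j) :
    ∃! d : c.pt ⟶ Z, ∀ j, c.ι.app j ≫ d = t j :=
  hc.existsUnique
    { pt := Z
      ι := { app := t
             naturality := fun _ _ u => (ht u).trans (Category.comp_id _).symm } }

variable [HasBinaryCoproducts C]

/-- The functor `H (-) + Y`. -/
@[simps]
noncomputable def addConst (H : C ⥤ C) (Y : C) : C ⥤ C where
  obj X := H.obj X ⨿ Y
  map f := coprod.map (H.map f) (𝟙 Y)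

/-- The functor `A + (-)`. -/
@[simps]
noncomputable def constAdd (A : C) : C ⥤ C where
  obj X := A ⨿ X
  map f := coprod.map (𝟙 A) f

/-- Over a connected index category the `Y`-components of a compatible family do not depend on the
index, so adding a constant summand commutes with the colimit. -/
theorem existsUnique_coprod_desc {J : Type*} [Category* J] [IsConnected J] {F : J ⥤ C} {P : C}
    (p : ∀ j, F.obj j ⟶ P)
    (hP : ∀ {Z : C} (t : ∀ j, F.obj j ⟶ Z), (∀ {j k : J} (u : j ⟶ k), F.map u ≫ t k = t j) →
      ∃! d : P ⟶ Z, ∀ j, p j ≫ d = t j)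
    {Y Z : C} (t : ∀ j, F.obj j ⨿ Y ⟶ Z)
    (ht : ∀ {j k : J} (u : j ⟶ k), coprod.map (F.map u) (𝟙 Y) ≫ t k = t j) :
    ∃! m : P ⨿ Y ⟶ Z, ∀ j, coprod.map (p j) (𝟙 Y) ≫ m = t j := by
  have hr {j k : J} (u : j ⟶ k) : coprod.inr ≫ t j = coprod.inr ≫ t k := by
    simp [← ht u]
  obtain ⟨d, hd, hd'⟩ := hP (fun j => coprod.inl ≫ t j) fun u => by simp [← ht u]
  refine ⟨coprod.desc d (coprod.inr ≫ t (Classical.arbitrary J)), fun j => ?_, fun m hm => ?_⟩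
  · ext
    · simp [hd]
    · simpa using constant_of_preserves_morphisms (fun j => coprod.inr ≫ t j)
        (fun _ _ u => hr u) _ j
  · ext
    · rw [coprod.inl_desc, ← hd' (coprod.inl ≫ m) fun j => ?_]
      simp only [← hm j, coprod.inl_map_assoc]
    · simp [← hm (Classical.arbitrary J)]

instance addConst_preservesColimitsOfShape (H : C ⥤ C) (Y : C) (J : Type*) [Category* J]
    [IsConnected J] [PreservesColimitsOfShape J H] :
    PreservesColimitsOfShape J (addConst H Y) where
  preservesColimit {_} :=
    { preserves := fun hc => ⟨IsColimit.ofExistsUnique fun s =>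
        existsUnique_coprod_desc (F := _ ⋙ H) _ (isColimitOfPreserves H hc).existsUnique_desc s.ι.app s.w⟩ }

instance constAdd_preservesColimitsOfShape (A : C) (J : Type*) [Category* J] [IsConnected J] :
    PreservesColimitsOfShape J (constAdd A) :=
  have braid {X Y : C} (f : X ⟶ Y) : (coprod.braiding X A).hom ≫ coprod.map (𝟙 A) f =
      coprod.map f (𝟙 A) ≫ (coprod.braiding Y A).hom := by ext <;> simp
  preservesColimitsOfShape_of_natIso (F := addConst (𝟭 C) A)
    (NatIso.ofComponents (fun X => coprod.braiding X A) fun f => (braid f).symm)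

end Presentability

/-! ### The filtered category of finitely presentable coalgebras -/

section FinitelyPresentableCoalgebras

open Endofunctor

variable {C : Type u} [Category.{v} C] (G : C ⥤ C)

/-- Coalgebras with a finitely presentable carrier. -/
def finitelyPresentableCoalgebra : ObjectProperty (Coalgebra G) :=
  fun c => IsFinitelyPresentable.{v} c.V

/-- The category of coalgebras with a finitely presentable carrier. -/
abbrev FPCoalgebra := (finitelyPresentableCoalgebra G).FullSubcategory

variable {G} in
/-- The coalgebra `e : X ⟶ G X` for finitely presentable `X`. -/
abbrev FPCoalgebra.mk {X : C} (hX : IsFinitelyPresentable.{v} X) (e : X ⟶ G.obj X) :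
    FPCoalgebra G :=
  ⟨⟨X, e⟩, hX⟩

variable {G} in
/-- A homomorphism of coalgebras with finitely presentable carriers. -/
abbrev FPCoalgebra.homMk {c d : FPCoalgebra G} (f : c.obj.V ⟶ d.obj.V)
    (h : c.obj.str ≫ G.map f = f ≫ d.obj.str) : c ⟶ d :=
  ObjectProperty.homMk ⟨f, h⟩

instance finitelyPresentableCoalgebra_essentiallySmall [IsLocallyFinitelyPresentable.{v} C] :
    ObjectProperty.EssentiallySmall.{v} (finitelyPresentableCoalgebra G) := by
  obtain ⟨Q, hQ, h₁, h₂⟩ := ObjectProperty.EssentiallySmall.exists_small_le.{v}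
    (isCardinalPresentable C Cardinal.aleph0.{v})
  refine ⟨ObjectProperty.ofObj (fun p : Σ X : Subtype Q, (X.1 ⟶ G.obj X.1) =>
    (⟨p.1.1, p.2⟩ : Coalgebra G)), ?_, ?_⟩
  · have : Small.{v} (Subtype Q) := hQ
    infer_instance
  · intro c hc
    obtain ⟨X, hX, ⟨i⟩⟩ := h₂ _ hc
    exact ⟨_, ⟨(⟨⟨X, hX⟩, i.inv ≫ c.str ≫ G.map i.hom⟩ : Σ X : Subtype Q, (X.1 ⟶ G.obj X.1))⟩,
      ⟨Coalgebra.isoMk i (by simp)⟩⟩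

variable [IsLocallyFinitelyPresentable.{v} C]

instance : EssentiallySmall.{v} (FPCoalgebra G) :=
  inferInstanceAs (EssentiallySmall.{v} (finitelyPresentableCoalgebra G).FullSubcategory)

/-- Coproducts and coequalizers of carriers inherit coalgebra structures, and finite presentability
survives both. -/
instance : IsFilteredOrEmpty (FPCoalgebra G) where
  cocone_objs c d := by
    refine ⟨FPCoalgebra.mk (IsFinitelyPresentable.coprod c.property d.property)
      (coprod.desc (c.obj.str ≫ G.map coprod.inl) (d.obj.str ≫ G.map coprod.inr)),
      FPCoalgebra.homMk coprod.inl (coprod.inl_desc _ _).symm,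
      FPCoalgebra.homMk coprod.inr (coprod.inr_desc _ _).symm, trivial⟩
  cocone_maps c d f g := by
    refine ⟨FPCoalgebra.mk (IsFinitelyPresentable.coequalizer f.hom.f g.hom.f c.property d.property)
      (coequalizer.desc (d.obj.str ≫ G.map (coequalizer.π f.hom.f g.hom.f)) ?_),
      FPCoalgebra.homMk (coequalizer.π _ _) ?_, ?_⟩
    · rw [← Coalgebra.Hom.h_assoc, ← Coalgebra.Hom.h_assoc, ← G.map_comp, ← G.map_comp,
        coequalizer.condition]
    · simp
    · ext
      exact coequalizer.condition _ _

/-- The carrier functor. -/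
abbrev FPCoalgebra.carrier : FPCoalgebra G ⥤ C :=
  (finitelyPresentableCoalgebra G).ι ⋙ Coalgebra.forget G

end FinitelyPresentableCoalgebras

/-! ### The rational coalgebra and its fixed-point property -/

section RationalCoalgebra

open Endofunctor

variable {C : Type u} [Category.{v} C] [IsLocallyFinitelyPresentable.{v} C]

theorem hom_ext_of_finitelyPresentable {Z W : C} {d d' : Z ⟶ W}
    (h : ∀ (Q : C), IsFinitelyPresentable.{v} Q → ∀ g : Q ⟶ Z, g ≫ d = g ≫ d') : d = d' := by
  obtain ⟨J, _, _, D, c, hc, rfl, hD⟩ := exists_filtered_presentation Z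
  exact hc.hom_ext fun j => h _ (hD j) _

theorem exists_hom_of_finitelyPresentable {Z W : C}
    (φ : ∀ (Q : C), IsFinitelyPresentable.{v} Q → (Q ⟶ Z) → (Q ⟶ W))
    (hφ : ∀ {Q Q' : C} (hQ : IsFinitelyPresentable.{v} Q) (hQ' : IsFinitelyPresentable.{v} Q')
      (u : Q ⟶ Q') (g : Q' ⟶ Z), u ≫ φ Q' hQ' g = φ Q hQ (u ≫ g)) :
    ∃ d : Z ⟶ W, ∀ Q hQ g, g ≫ d = φ Q hQ g := by
  obtain ⟨J, _, _, D, c, hc, rfl, hD⟩ := exists_filtered_presentation Z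
  obtain ⟨d, hd, -⟩ := hc.existsUnique_desc (fun j => φ _ (hD j) (c.ι.app j))
    fun {j k} u => by rw [hφ (hD j), c.w]
  refine ⟨d, fun Q hQ g => ?_⟩
  obtain ⟨j, p, rfl⟩ := IsFinitelyPresentable.exists_hom_of_isColimit hc g
  rw [Category.assoc, hd, hφ]

instance (G : C ⥤ C) : IsFiltered (FPCoalgebra G) where
  nonempty := by
    have : ∀ k : Discrete PEmpty.{1}, IsCardinalPresentable.{v}
        ((Functor.empty C).obj k) Cardinal.aleph0 := by rintro ⟨⟨⟩⟩
    have h : IsFinitelyPresentable.{v} (⊥_ C) :=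
      isCardinalPresentable_of_isColimit.{v} (colimit.cocone (Functor.empty C))
        (colimit.isColimit _) _ (by rw [hasCardinalLT_aleph0_iff]; infer_instance)
    exact ⟨FPCoalgebra.mk h (initial.to _)⟩

theorem isCardinalFiltered_fpCoalgebra (G : C ⥤ C) :
    IsCardinalFiltered (FPCoalgebra G) Cardinal.aleph0.{v} :=
  (isCardinalFiltered_aleph0_iff _).2 inferInstance

instance (G : C ⥤ C) : HasColimitsOfShape (FPCoalgebra G) C :=
  hasColimitsOfShape_of_essentiallySmall.{v} _ _

variable (G : C ⥤ C)

/-- The colimit of all coalgebras with a finitely presentable carrier. -/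
noncomputable def rationalCarrier : C := colimit (FPCoalgebra.carrier G)

variable {G} in
/-- The colimit injections. -/
noncomputable def FPCoalgebra.inj (c : FPCoalgebra G) : c.obj.V ⟶ rationalCarrier G :=
  colimit.ι (FPCoalgebra.carrier G) c

/-- The colimit cocone. -/
noncomputable def rationalCocone : Cocone (FPCoalgebra.carrier G) where
  pt := rationalCarrier G
  ι :=
    { app := fun c => c.inj
      naturality := (colimit.cocone (FPCoalgebra.carrier G)).ι.naturality }

/-- The universal property of `rationalCarrier G`. -/
noncomputable def isColimitRationalCocone : IsColimit (rationalCocone G) :=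
  colimit.isColimit (FPCoalgebra.carrier G)

variable {G}

theorem FPCoalgebra.w_inj {c d : FPCoalgebra G} (f : c ⟶ d) : f.hom.f ≫ d.inj = c.inj :=
  (rationalCocone G).w f

theorem rationalCarrier_hom_ext {Z : C} {f g : rationalCarrier G ⟶ Z}
    (h : ∀ c : FPCoalgebra G, c.inj ≫ f = c.inj ≫ g) : f = g :=
  (isColimitRationalCocone G).hom_ext h

theorem existsUnique_rationalCarrier_desc {Z : C} (t : ∀ c : FPCoalgebra G, c.obj.V ⟶ Z)
    (ht : ∀ {c d : FPCoalgebra G} (f : c ⟶ d), f.hom.f ≫ t d = t c) :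
    ∃! m : rationalCarrier G ⟶ Z, ∀ c : FPCoalgebra G, c.inj ≫ m = t c :=
  (isColimitRationalCocone G).existsUnique_desc t ht

theorem exists_rationalStr : ∃ r : rationalCarrier G ⟶ G.obj (rationalCarrier G),
    ∀ c : FPCoalgebra G, c.inj ≫ r = c.obj.str ≫ G.map c.inj := by
  obtain ⟨r, hr, -⟩ := existsUnique_rationalCarrier_desc
    (fun c : FPCoalgebra G => c.obj.str ≫ G.map c.inj) fun {c d} f => by
      rw [← Coalgebra.Hom.h_assoc, ← G.map_comp, FPCoalgebra.w_inj]
  exact ⟨r, hr⟩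

variable (G) in
/-- The coalgebra structure of the colimit. -/
noncomputable def rationalStr : rationalCarrier G ⟶ G.obj (rationalCarrier G) :=
  exists_rationalStr.choose

theorem FPCoalgebra.inj_str (c : FPCoalgebra G) :
    c.inj ≫ rationalStr G = c.obj.str ≫ G.map c.inj :=
  exists_rationalStr.choose_spec c

theorem exists_factor_of_preserves {X : C} (hX : IsFinitelyPresentable.{v} X)
    (F : C ⥤ C) [Functor.IsFinitelyAccessible.{v} F] (f : X ⟶ F.obj (rationalCarrier G)) :
    ∃ (c : FPCoalgebra G) (g : X ⟶ F.obj c.obj.V), g ≫ F.map c.inj = f := by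
  have := isCardinalFiltered_fpCoalgebra G
  have := F.preservesColimitsOfShape_of_isCardinalAccessible_of_essentiallySmall
    Cardinal.aleph0.{v} (FPCoalgebra G)
  exact IsCardinalPresentable.exists_hom_of_isColimit Cardinal.aleph0.{v}
    (isColimitOfPreserves F (isColimitRationalCocone G)) f

theorem exists_eq_of_preserves {X : C} (hX : IsFinitelyPresentable.{v} X)
    (F : C ⥤ C) [Functor.IsFinitelyAccessible.{v} F] {c : FPCoalgebra G} (f g : X ⟶ F.obj c.obj.V)
    (h : f ≫ F.map c.inj = g ≫ F.map c.inj) :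
    ∃ (d : FPCoalgebra G) (u : c ⟶ d), f ≫ F.map u.hom.f = g ≫ F.map u.hom.f := by
  have := isCardinalFiltered_fpCoalgebra G
  have := F.preservesColimitsOfShape_of_isCardinalAccessible_of_essentiallySmall
    Cardinal.aleph0.{v} (FPCoalgebra G)
  exact IsCardinalPresentable.exists_eq_of_isColimit' Cardinal.aleph0.{v}
    (isColimitOfPreserves F (isColimitRationalCocone G)) f g h

theorem rationalCarrier_map_hom_ext (F : C ⥤ C) [Functor.IsFinitelyAccessible.{v} F] {Z : C}
    {f g : F.obj (rationalCarrier G) ⟶ Z}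
    (h : ∀ c : FPCoalgebra G, F.map c.inj ≫ f = F.map c.inj ≫ g) : f = g := by
  have := isCardinalFiltered_fpCoalgebra G
  have := F.preservesColimitsOfShape_of_isCardinalAccessible_of_essentiallySmall
    Cardinal.aleph0.{v} (FPCoalgebra G)
  exact (isColimitOfPreserves F (isColimitRationalCocone G)).hom_ext h

theorem exists_rationalCarrier_map_desc (F : C ⥤ C) [Functor.IsFinitelyAccessible.{v} F] {Z : C}
    (t : ∀ c : FPCoalgebra G, F.obj c.obj.V ⟶ Z)
    (ht : ∀ {c d : FPCoalgebra G} (f : c ⟶ d), F.map f.hom.f ≫ t d = t c) :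
    ∃ m : F.obj (rationalCarrier G) ⟶ Z, ∀ c : FPCoalgebra G, F.map c.inj ≫ m = t c := by
  have := isCardinalFiltered_fpCoalgebra G
  have := F.preservesColimitsOfShape_of_isCardinalAccessible_of_essentiallySmall
    Cardinal.aleph0.{v} (FPCoalgebra G)
  exact ((isColimitOfPreserves F (isColimitRationalCocone G)).existsUnique_desc t ht).exists

variable [Functor.IsFinitelyAccessible.{v} G]

/-- The colimit injections are the only homomorphisms into the rational coalgebra. -/
theorem FPCoalgebra.eq_inj (c : FPCoalgebra G) (f : c.obj.V ⟶ rationalCarrier G)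
    (hf : f ≫ rationalStr G = c.obj.str ≫ G.map f) : f = c.inj := by
  obtain ⟨d, f, rfl⟩ := exists_factor_of_preserves c.property (𝟭 C) f
  simp only [Functor.id_obj, Functor.id_map] at *
  -- The factor through `d` need not be a homomorphism, but the two sides of the homomorphism
  -- equation agree in `G` of the colimit. As `G` is finitary, they already agree at a later stage
  -- `d'`.
  obtain ⟨d', u, hu⟩ := exists_eq_of_preserves c.property G (c := d) (f ≫ d.obj.str)
    (c.obj.str ≫ G.map f) (by
      rw [Category.assoc, ← FPCoalgebra.inj_str, ← Category.assoc, hf, Category.assoc, G.map_comp])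
  rw [← FPCoalgebra.w_inj u, ← Category.assoc]
  refine FPCoalgebra.w_inj (c := c) (d := d') (FPCoalgebra.homMk (f ≫ u.hom.f) ?_)
  rw [G.map_comp, ← Category.assoc, ← hu, Category.assoc, Category.assoc, u.hom.h]

/-- The coalgebra `Q + X`, for `c : X ⟶ G X` and `g : Q ⟶ G X`. -/
noncomputable abbrev FPCoalgebra.extend (c : FPCoalgebra G) {Q : C}
    (hQ : IsFinitelyPresentable.{v} Q) (g : Q ⟶ G.obj c.obj.V) : FPCoalgebra G :=
  FPCoalgebra.mk (X := Q ⨿ c.obj.V) (IsFinitelyPresentable.coprod hQ c.property)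
    (coprod.desc g c.obj.str ≫ G.map coprod.inr)

omit [Functor.IsFinitelyAccessible.{v} G] in
theorem FPCoalgebra.inr_inj_extend (c : FPCoalgebra G) {Q : C} (hQ : IsFinitelyPresentable.{v} Q)
    (g : Q ⟶ G.obj c.obj.V) : coprod.inr ≫ (c.extend hQ g).inj = c.inj :=
  FPCoalgebra.w_inj (FPCoalgebra.homMk (c := c) (d := c.extend hQ g) coprod.inr (by simp))

omit [Functor.IsFinitelyAccessible.{v} G] in
-- The coproduct `u + f` is a homomorphism of the extended coalgebras. This is what makes the
-- inverse of the rational structure well defined.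
theorem FPCoalgebra.inl_inj_extend_of_hom {c d : FPCoalgebra G} (f : c ⟶ d) {Q Q' : C}
    (hQ : IsFinitelyPresentable.{v} Q) (hQ' : IsFinitelyPresentable.{v} Q')
    (g : Q ⟶ G.obj c.obj.V) (g' : Q' ⟶ G.obj d.obj.V) (u : Q ⟶ Q')
    (h : u ≫ g' = g ≫ G.map f.hom.f) :
    u ≫ coprod.inl ≫ (d.extend hQ' g').inj = coprod.inl ≫ (c.extend hQ g).inj := by
  rw [← FPCoalgebra.w_inj (FPCoalgebra.homMk (c := c.extend hQ g) (d := d.extend hQ' g')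
    (coprod.map u f.hom.f) ?_)]
  · exact (coprod.inl_map_assoc u f.hom.f _).symm
  dsimp only
  rw [Category.assoc, ← G.map_comp, coprod.inr_map, coprod.map_desc_assoc, h, ← f.hom.h, G.map_comp,
    ← Category.assoc, coprod.desc_comp]

/-- A generalized element of `G` of the colimit on a finitely presentable `Q` comes from some `g : Q
⟶ G X`. It is sent to the fresh variables `Q` of the coalgebra `Q + X`, and these assignments glue.
-/
theorem exists_rationalInv : ∃ j : G.obj (rationalCarrier G) ⟶ rationalCarrier G,
    ∀ (c : FPCoalgebra G) (Q : C) (hQ : IsFinitelyPresentable.{v} Q) (g : Q ⟶ G.obj c.obj.V),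
      g ≫ G.map c.inj ≫ j = coprod.inl ≫ (c.extend hQ g).inj := by
  choose t ht using fun c : FPCoalgebra G => exists_hom_of_finitelyPresentable
    (Z := G.obj c.obj.V) (fun Q hQ g => coprod.inl ≫ (c.extend hQ g).inj)
    fun hQ hQ' u g => FPCoalgebra.inl_inj_extend_of_hom (𝟙 c) hQ hQ' (u ≫ g) g u (by simp)
  obtain ⟨j, hj⟩ := exists_rationalCarrier_map_desc (G := G) G t fun {c d} f =>
    hom_ext_of_finitelyPresentable fun Q hQ g => by
      rw [ht c Q hQ, ← Category.assoc, ht d Q hQ (g ≫ G.map f.hom.f)]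
      simpa using FPCoalgebra.inl_inj_extend_of_hom f hQ hQ g (g ≫ G.map f.hom.f) (𝟙 Q) (by simp)
  exact ⟨j, fun c Q hQ g => by rw [hj, ht]⟩

/-- Lambek's lemma for the rational coalgebra. -/
instance rationalStr_isIso : IsIso (rationalStr G) := by
  obtain ⟨j, hj⟩ := exists_rationalInv (G := G)
  refine ⟨j, rationalCarrier_hom_ext fun c => ?_, rationalCarrier_map_hom_ext G fun c =>
    hom_ext_of_finitelyPresentable fun Q hQ g => ?_⟩
  -- When `g` is the structure of `c` itself, the codiagonal is a homomorphism from the extension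
  -- back to `c`.
  · rw [reassoc_of% c.inj_str, hj c _ c.property, Category.comp_id,
      ← FPCoalgebra.w_inj (FPCoalgebra.homMk (c := c.extend c.property c.obj.str) (d := c)
        (coprod.desc (𝟙 _) (𝟙 _)) ?_)]
    · simp
    · dsimp only
      ext <;> simp [← G.map_comp]
  · have := hj c Q hQ g
    simp only [Category.comp_id]
    rw [reassoc_of% this, FPCoalgebra.inj_str]
    simp only [coprod.inl_desc_assoc, Category.assoc, ← G.map_comp, FPCoalgebra.inr_inj_extend]

end RationalCoalgebra

/-! ### Iterativity and freeness of the rational algebra -/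

section RationalAlgebra

open Endofunctor

variable {C : Type u} [Category.{v} C]

section Solutions

variable [HasBinaryCoproducts C] {H : C ⥤ C} {A : Algebra H}

theorem isSolution_iff {X : C} {e : X ⟶ H.obj X ⨿ A.a} {s : X ⟶ A.a} :
    IsSolution A e s ↔ s = e ≫ coprod.desc (H.map s ≫ A.str) (𝟙 A.a) := by
  rw [IsSolution, coprod.map_desc, Category.id_comp]

theorem IsSolution.precomp {X X' : C} {e : X ⟶ H.obj X ⨿ A.a} {e' : X' ⟶ H.obj X' ⨿ A.a}
    {s : X' ⟶ A.a} (hs : IsSolution A e' s) (f : X ⟶ X')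
    (hf : e ≫ coprod.map (H.map f) (𝟙 A.a) = f ≫ e') : IsSolution A e (f ≫ s) := by
  rw [isSolution_iff] at hs ⊢
  conv_lhs => rw [hs, ← Category.assoc, ← hf]
  simp

/-- Unique solvability is inherited by colimits of equation morphisms. -/
theorem existsUnique_solution_of_colimit {J : Type*} [Category* J] {D : J ⥤ C} {P : C}
    (p : ∀ j, D.obj j ⟶ P)
    (hP : ∀ {Z : C} (t : ∀ j, D.obj j ⟶ Z), (∀ {j k : J} (u : j ⟶ k), D.map u ≫ t k = t j) →
      ∃! d : P ⟶ Z, ∀ j, p j ≫ d = t j)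
    (e : P ⟶ H.obj P ⨿ A.a) (e' : ∀ j, D.obj j ⟶ H.obj (D.obj j) ⨿ A.a)
    (he : ∀ j, e' j ≫ coprod.map (H.map (p j)) (𝟙 A.a) = p j ≫ e)
    (he' : ∀ {j k : J} (u : j ⟶ k),
      e' j ≫ coprod.map (H.map (D.map u)) (𝟙 A.a) = D.map u ≫ e' k)
    (h : ∀ j, ∃! s, IsSolution A (e' j) s) : ∃! s, IsSolution A e s := by
  choose t ht ht' using h
  obtain ⟨s, hs, hs'⟩ := hP t fun {j k} u => ht' _ _ ((ht k).precomp _ (he' u))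
  refine ⟨s, isSolution_iff.2 ?_, fun s₁ hs₁ => hs' _ fun j => ht' _ _ (hs₁.precomp _ (he j))⟩
  refine (hP t fun {j k} u => ht' _ _ ((ht k).precomp _ (he' u))).unique hs fun j => ?_
  rw [← Category.assoc, ← he, Category.assoc, coprod.map_desc, ← Category.assoc, ← H.map_comp, hs,
    Category.id_comp]
  exact (isSolution_iff.1 (ht j)).symm

/-- An algebra `A` with an isomorphism `A ≅ H A + Y` whose first component is inverse to the
structure: solutions of `e : X ⟶ H X + V`, for a coalgebra `V` of `H (-) + Y` with a homomorphism
into `A`, are homomorphisms on `X + V`. -/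
theorem isSolution_iff_hom {Y X V : C} (out : A.a ⟶ H.obj A.a ⨿ Y) [IsIso out]
    (hA : A.str = coprod.inl ≫ inv out) (e : X ⟶ H.obj X ⨿ V) (v : V ⟶ H.obj V ⨿ Y) (i : V ⟶ A.a)
    (hi : i ≫ out = v ≫ coprod.map (H.map i) (𝟙 Y)) (s : X ⟶ A.a) :
    IsSolution A (e ≫ coprod.map (𝟙 _) i) s ↔
      coprod.desc s i ≫ out = coprod.desc
        (e ≫ coprod.desc (H.map coprod.inl ≫ coprod.inl) (v ≫ coprod.map (H.map coprod.inr) (𝟙 Y)))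
        (v ≫ coprod.map (H.map coprod.inr) (𝟙 Y)) ≫
          coprod.map (H.map (coprod.desc s i)) (𝟙 Y) := by
  rw [isSolution_iff, ← cancel_mono out]
  have h : (e ≫ coprod.desc (H.map coprod.inl ≫ coprod.inl)
      (v ≫ coprod.map (H.map coprod.inr) (𝟙 Y))) ≫ coprod.map (H.map (coprod.desc s i)) (𝟙 Y) =
      ((e ≫ coprod.map (𝟙 _) i) ≫ coprod.desc (H.map s ≫ A.str) (𝟙 A.a)) ≫ out := by
    simp [hA, hi, ← H.map_comp_assoc, ← H.map_comp]
  have h' : (v ≫ coprod.map (H.map coprod.inr) (𝟙 Y)) ≫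
      coprod.map (H.map (coprod.desc s i)) (𝟙 Y) = i ≫ out := by
    simp [hi, ← H.map_comp]
  rw [coprod.desc_comp, coprod.desc_comp, h, h']
  exact ⟨fun h => by rw [h], fun h => by simpa only [coprod.inl_desc] using coprod.inl ≫= h⟩

/-- Inverting `out` separates the equation into its two summands. Freeness thereby reduces to unique
solvability of one equation. -/
theorem isSolution_iff_extends {A₀ : Algebra H} {Y : C} (out : A₀.a ⟶ H.obj A₀.a ⨿ Y) [IsIso out]
    (hA₀ : A₀.str = coprod.inl ≫ inv out) (f : Y ⟶ A.a) (s : A₀.a ⟶ A.a) :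
    IsSolution A (out ≫ coprod.map (𝟙 _) f) s ↔
      H.map s ≫ A.str = A₀.str ≫ s ∧ (coprod.inr ≫ inv out) ≫ s = f := by
  rw [isSolution_iff, Category.assoc, coprod.map_desc, Category.id_comp, Category.comp_id,
    ← IsIso.inv_comp_eq, hA₀, Category.assoc, Category.assoc]
  constructor
  · intro h
    rw [h]
    simp
  · rintro ⟨h₁, h₂⟩
    ext
    · simp [h₁]
    · simp [h₂]

theorem existsUnique_solution_of_colimit_coalgebra {J : Type*} [Category* J] {D : J ⥤ C} {P Y : C}
    (p : ∀ j, D.obj j ⟶ P)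
    (hP : ∀ {Z : C} (t : ∀ j, D.obj j ⟶ Z), (∀ {j k : J} (u : j ⟶ k), D.map u ≫ t k = t j) →
      ∃! d : P ⟶ Z, ∀ j, p j ≫ d = t j)
    (e : P ⟶ H.obj P ⨿ Y) (e' : ∀ j, D.obj j ⟶ H.obj (D.obj j) ⨿ Y)
    (he : ∀ j, p j ≫ e = e' j ≫ coprod.map (H.map (p j)) (𝟙 Y))
    (he' : ∀ {j k : J} (u : j ⟶ k),
      e' j ≫ coprod.map (H.map (D.map u)) (𝟙 Y) = D.map u ≫ e' k)
    (hA : IsIterative A) (hD : ∀ j, IsFinitelyPresentable.{v} (D.obj j)) (f : Y ⟶ A.a) :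
    ∃! s, IsSolution A (e ≫ coprod.map (𝟙 _) f) s :=
  existsUnique_solution_of_colimit p hP _ (fun j => e' j ≫ coprod.map (𝟙 _) f)
    (fun j => by rw [← Category.assoc (p j), he]; simp)
    (fun u => by rw [← Category.assoc (D.map u), ← he']; simp) fun j => hA _ (hD j) _

end Solutions

variable [IsLocallyFinitelyPresentable.{v} C]

variable (C) in
theorem hasBinaryCoproducts_of_isLocallyFinitelyPresentable : HasBinaryCoproducts C :=
  haveI : HasColimitsOfSize.{v, v} C := IsCardinalLocallyPresentable.toHasColimitsOfSize
    Cardinal.aleph0.{v}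
  inferInstance

attribute [local instance] hasBinaryCoproducts_of_isLocallyFinitelyPresentable

instance addConst_isFinitelyAccessible (H : C ⥤ C) [Functor.IsFinitelyAccessible.{v} H] (Y : C) :
    Functor.IsFinitelyAccessible.{v} (addConst H Y) where
  preservesColimitOfShape J _ hJ := by
    have := (isCardinalFiltered_aleph0_iff J).1 hJ
    have := IsFiltered.isConnected J
    have := H.preservesColimitsOfShape_of_isCardinalAccessible Cardinal.aleph0.{v} J
    infer_instance

instance constAdd_isFinitelyAccessible (A : C) :
    Functor.IsFinitelyAccessible.{v} (constAdd A) where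
  preservesColimitOfShape J _ hJ := by
    have := (isCardinalFiltered_aleph0_iff J).1 hJ
    have := IsFiltered.isConnected J
    infer_instance

/-- The structure of the rational coalgebra, with its codomain displayed as a coproduct. -/
noncomputable def rationalOut (H : C ⥤ C) (Y : C) : rationalCarrier (addConst H Y) ⟶
    H.obj (rationalCarrier (addConst H Y)) ⨿ Y :=
  rationalStr (addConst H Y)

theorem inj_rationalOut {H : C ⥤ C} {Y : C} (c : FPCoalgebra (addConst H Y)) :
    c.inj ≫ rationalOut H Y = c.obj.str ≫ coprod.map (H.map c.inj) (𝟙 Y) :=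
  c.inj_str

variable (H : C ⥤ C) [Functor.IsFinitelyAccessible.{v} H]

instance (Y : C) : IsIso (rationalOut H Y) :=
  inferInstanceAs (IsIso (rationalStr (addConst H Y)))

/-- The rational coalgebra of `H (-) + Y` as an `H`-algebra. -/
noncomputable abbrev rationalAlgebra (Y : C) : Algebra H where
  a := rationalCarrier (addConst H Y)
  str := coprod.inl ≫ inv (rationalOut H Y)

/-- The universal arrow of the rational algebra. -/
noncomputable abbrev rationalUnit (Y : C) : Y ⟶ rationalCarrier (addConst H Y) :=
  coprod.inr ≫ inv (rationalOut H Y)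

variable {H}

theorem isIterative_rationalAlgebra (Y : C) : IsIterative (rationalAlgebra H Y) := by
  intro X hX e
  -- Since `X` is finitely presentable, the parameters of `e` lie in one coalgebra `c`. Merging `e₀`
  -- with `c` gives the coalgebra `E`, and solutions of `e` become homomorphisms from `E`.
  obtain ⟨c, e₀, rfl⟩ := exists_factor_of_preserves hX (constAdd (H.obj X)) e
  let E : FPCoalgebra (addConst H Y) :=
    FPCoalgebra.mk (X := X ⨿ c.obj.V) (IsFinitelyPresentable.coprod hX c.property)
      (coprod.desc (e₀ ≫ coprod.desc (H.map coprod.inl ≫ coprod.inl)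
        (c.obj.str ≫ coprod.map (H.map coprod.inr) (𝟙 Y)))
        (c.obj.str ≫ coprod.map (H.map coprod.inr) (𝟙 Y)))
  have hr : coprod.inr ≫ E.inj = c.inj :=
    FPCoalgebra.w_inj (FPCoalgebra.homMk (c := c) (d := E) coprod.inr
      (coprod.inr_desc _ _).symm)
  have key := isSolution_iff_hom (A := rationalAlgebra H Y) (rationalOut H Y) rfl e₀ c.obj.str
    c.inj (inj_rationalOut c)
  refine ⟨coprod.inl ≫ E.inj, (key _).2 ?_, fun s hs => ?_⟩
  · have h : coprod.desc (coprod.inl ≫ E.inj) c.inj = E.inj := by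
      ext
      · exact coprod.inl_desc _ _
      · exact (coprod.inr_desc _ _).trans hr.symm
    exact (congrArg (· ≫ rationalOut H Y) h).trans ((inj_rationalOut E).trans
      (congrArg (fun t => E.obj.str ≫ coprod.map (H.map t) (𝟙 Y)) h.symm))
  · exact (coprod.inl_desc _ _).symm.trans
      (congrArg (coprod.inl ≫ ·) (E.eq_inj (coprod.desc s c.inj) ((key s).1 hs)))

omit [Functor.IsFinitelyAccessible.{v} H] in
theorem existsUnique_solution_rationalOut {Y : C} {A : Algebra H} (hA : IsIterative A)
    (f : Y ⟶ A.a) : ∃! s, IsSolution A (rationalOut H Y ≫ coprod.map (𝟙 _) f) s :=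
  existsUnique_solution_of_colimit_coalgebra (D := FPCoalgebra.carrier (addConst H Y))
    (fun c => c.inj) existsUnique_rationalCarrier_desc _
    (fun c => c.obj.str) inj_rationalOut (fun u => u.hom.h) hA (fun c => c.property) f

variable (H) in
/-- The rational algebra on `Y` is a free iterative algebra on `Y`. -/
noncomputable def rationalFreeIterativeAlgebra (Y : C) : FreeIterativeAlgebra H Y where
  alg := rationalAlgebra H Y
  iterative := isIterative_rationalAlgebra Y
  η := rationalUnit H Y
  universal B hB f := by
    obtain ⟨s, hs, hs'⟩ := existsUnique_solution_rationalOut hB f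
    have key := isSolution_iff_extends (A := B) (A₀ := rationalAlgebra H Y) (rationalOut H Y) rfl f
    refine ⟨⟨s, ((key s).1 hs).1⟩, ((key s).1 hs).2, fun h hh => ?_⟩
    ext
    exact hs' _ ((key h.f).2 ⟨h.h, hh⟩)

end RationalAlgebra

/-! ### Distributivity and equations induced by a point-strength -/

section StrengthLifting

open Endofunctor

variable {C : Type u} [Category.{v} C] [MonoidalCategory C] [HasBinaryCoproducts C]

section Distributivity

variable (P Q W : C) [PreservesColimit (pair P Q) (tensorRight W)]

/-- The inverse of the canonical morphism `P ⊗ W + Q ⊗ W ⟶ (P + Q) ⊗ W`. -/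
noncomputable def distrib : (P ⨿ Q) ⊗ W ⟶ (P ⊗ W) ⨿ (Q ⊗ W) :=
  inv (coprodComparison (tensorRight W) P Q)

instance : IsIso (distrib P Q W) := inferInstanceAs (IsIso (inv _))

@[simp]
theorem inl_whiskerRight_distrib : (coprod.inl : P ⟶ P ⨿ Q) ▷ W ≫ distrib P Q W = coprod.inl := by
  have h := coprodComparison_inl (F := tensorRight W) (A := P) (B := Q)
  change _ = coprod.inl ▷ W at h
  rw [distrib, ← h, Category.assoc, IsIso.hom_inv_id]
  exact Category.comp_id _

@[simp]
theorem inr_whiskerRight_distrib : (coprod.inr : Q ⟶ P ⨿ Q) ▷ W ≫ distrib P Q W = coprod.inr := by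
  have h := coprodComparison_inr (F := tensorRight W) (A := P) (B := Q)
  change _ = coprod.inr ▷ W at h
  rw [distrib, ← h, Category.assoc, IsIso.hom_inv_id]
  exact Category.comp_id _

@[simp]
theorem inl_inv_distrib : coprod.inl ≫ inv (distrib P Q W) = coprod.inl ▷ W := by
  rw [IsIso.comp_inv_eq, inl_whiskerRight_distrib]

@[simp]
theorem inl_inv_distrib_assoc {Z : C} (h : (P ⨿ Q) ⊗ W ⟶ Z) :
    coprod.inl ≫ inv (distrib P Q W) ≫ h = coprod.inl ▷ W ≫ h := by
  rw [← Category.assoc, inl_inv_distrib]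

@[simp]
theorem inr_inv_distrib : coprod.inr ≫ inv (distrib P Q W) = coprod.inr ▷ W := by
  rw [IsIso.comp_inv_eq, inr_whiskerRight_distrib]

@[simp]
theorem inr_inv_distrib_assoc {Z : C} (h : (P ⨿ Q) ⊗ W ⟶ Z) :
    coprod.inr ≫ inv (distrib P Q W) ≫ h = coprod.inr ▷ W ≫ h := by
  rw [← Category.assoc, inr_inv_distrib]

variable {P Q W}

theorem distrib_hom_ext {Z : C} {f g : (P ⨿ Q) ⊗ W ⟶ Z}
    (h₁ : coprod.inl ▷ W ≫ f = coprod.inl ▷ W ≫ g)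
    (h₂ : coprod.inr ▷ W ≫ f = coprod.inr ▷ W ≫ g) : f = g := by
  rw [← cancel_epi (inv (distrib P Q W))]
  ext <;> simpa [← Category.assoc]

theorem distrib_naturality {P' Q' W' : C} [PreservesColimit (pair P' Q') (tensorRight W')]
    (p : P ⟶ P') (q : Q ⟶ Q') (w : W ⟶ W') :
    (coprod.map p q ⊗ₘ w) ≫ distrib P' Q' W' =
      distrib P Q W ≫ coprod.map (p ⊗ₘ w) (q ⊗ₘ w) := by
  apply distrib_hom_ext
  · rw [reassoc_of% inl_whiskerRight_distrib P Q W, coprod.inl_map, ← tensorHom_id, tensorHom_comp_tensorHom_assoc,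
      coprod.inl_map, Category.id_comp, tensorHom_def' p w, Category.assoc,
      ← inl_whiskerRight_distrib P' Q' W', tensorHom_def']
    simp
  · rw [reassoc_of% inr_whiskerRight_distrib P Q W, coprod.inr_map, ← tensorHom_id, tensorHom_comp_tensorHom_assoc,
      coprod.inr_map, Category.id_comp, tensorHom_def' q w, Category.assoc,
      ← inr_whiskerRight_distrib P' Q' W', tensorHom_def']
    simp

end Distributivity

variable [∀ P Q W : C, PreservesColimit (pair P Q) (tensorRight W)] {H : C ⥤ C}
  (s : PointStrength H)

/-- The equation morphism with variables `W ⊗ Y` induced by a pointed coalgebra `W` of `H (-) + X`,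
a pointed object `Y` and a morphism `X ⊗ Y ⟶ Z`. -/
noncomputable def strengthEquation (W Y : Under (𝟙_ C)) {X Z : C}
    (e : W.right ⟶ H.obj W.right ⨿ X) (f : X ⊗ Y.right ⟶ Z) :
    W.right ⊗ Y.right ⟶ H.obj (W.right ⊗ Y.right) ⨿ Z :=
  e ▷ Y.right ≫ distrib _ _ _ ≫ coprod.map (s.app W Y) f

/-- This supplies the compatibility needed to view an equation as a colimit of smaller ones, in `W`
or in `Y`. -/
theorem strengthEquation_naturality {W W' Y Y' : Under (𝟙_ C)} (g : W ⟶ W') (k : Y ⟶ Y') {X Z : C}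
    {e : W.right ⟶ H.obj W.right ⨿ X} {e' : W'.right ⟶ H.obj W'.right ⨿ X}
    (he : e ≫ coprod.map (H.map g.right) (𝟙 X) = g.right ≫ e')
    {f : X ⊗ Y.right ⟶ Z} {f' : X ⊗ Y'.right ⟶ Z} (hf : X ◁ k.right ≫ f' = f) :
    strengthEquation s W Y e f ≫ coprod.map (H.map (g.right ⊗ₘ k.right)) (𝟙 Z) =
      (g.right ⊗ₘ k.right) ≫ strengthEquation s W' Y' e' f' := by
  have h : (g.right ⊗ₘ k.right) ≫ e' ▷ Y'.right =
      e ▷ Y.right ≫ (coprod.map (H.map g.right) (𝟙 X) ⊗ₘ k.right) := by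
    rw [← tensorHom_id, ← tensorHom_id, tensorHom_comp_tensorHom, tensorHom_comp_tensorHom, he,
      Category.comp_id, Category.id_comp]
  rw [strengthEquation, strengthEquation, ← Category.assoc (g.right ⊗ₘ k.right), h, Category.assoc,
    Category.assoc, Category.assoc, reassoc_of% distrib_naturality (H.map g.right) (𝟙 X) k.right,
    coprod.map_map, coprod.map_map, s.naturality, id_tensorHom, hf, Category.comp_id]

theorem strengthEquation_naturality_left {W W' : Under (𝟙_ C)} (g : W.right ⟶ W'.right)
    (hg : W.hom ≫ g = W'.hom) (Y : Under (𝟙_ C)) {X Z : C}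
    {e : W.right ⟶ H.obj W.right ⨿ X} {e' : W'.right ⟶ H.obj W'.right ⨿ X}
    (he : e ≫ coprod.map (H.map g) (𝟙 X) = g ≫ e') (f : X ⊗ Y.right ⟶ Z) :
    strengthEquation s W Y e f ≫ coprod.map (H.map (g ▷ Y.right)) (𝟙 Z) =
      g ▷ Y.right ≫ strengthEquation s W' Y e' f := by
  simpa using strengthEquation_naturality s (Under.homMk g hg : W ⟶ W') (𝟙 Y) he
    (f := f) (f' := f) (by simp)

theorem isSolution_strengthEquation_iff {A : Algebra H} {W Y : Under (𝟙_ C)} {X : C}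
    (e : W.right ⟶ H.obj W.right ⨿ X) [IsIso e] (f : X ⊗ Y.right ⟶ A.a)
    (h : W.right ⊗ Y.right ⟶ A.a) :
    IsSolution A (strengthEquation s W Y e f) h ↔
      ((coprod.inl ≫ inv e) ▷ Y.right ≫ h = s.app W Y ≫ H.map h ≫ A.str ∧
        (coprod.inr ≫ inv e) ▷ Y.right ≫ h = f) := by
  rw [isSolution_iff, strengthEquation, Category.assoc, Category.assoc, coprod.map_desc,
    ← IsIso.inv_comp_eq, ← IsIso.inv_comp_eq, Category.comp_id, inv_whiskerRight,
    comp_whiskerRight, comp_whiskerRight, Category.assoc, Category.assoc]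
  constructor
  · intro hh
    exact ⟨by simpa using coprod.inl ≫= hh, by simpa using coprod.inr ≫= hh⟩
  · rintro ⟨h₁, h₂⟩
    ext
    · rw [← Category.assoc, inl_inv_distrib, h₁, coprod.inl_desc]
    · rw [← Category.assoc, inr_inv_distrib, h₂, coprod.inr_desc]

end StrengthLifting

/-! ### Closure properties of parametrized homomorphisms -/

section ParametrizedHomomorphisms

open Endofunctor

variable {C : Type u} [Category.{v} C] [MonoidalCategory C] {H : C ⥤ C} (s : PointStrength H)

/-- A morphism `h : B ⊗ Y ⟶ T` which is a homomorphism of algebras with parameter `Y`, with respect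
to the point `b` of `B`. -/
def IsParametrizedHom {B T : Algebra H} (b : 𝟙_ C ⟶ B.a) (Y : Under (𝟙_ C))
    (h : B.a ⊗ Y.right ⟶ T.a) : Prop :=
  B.str ▷ Y.right ≫ h = s.app (pointed b) Y ≫ H.map h ≫ T.str

namespace IsParametrizedHom

variable {s} {B B' T T' : Algebra H} {b : 𝟙_ C ⟶ B.a} {b' : 𝟙_ C ⟶ B'.a} {Y Y' Z : Under (𝟙_ C)}

theorem whiskerRight_comp {h : B'.a ⊗ Y.right ⟶ T.a} (hh : IsParametrizedHom s b' Y h) (g : B ⟶ B')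
    (hg : b ≫ g.f = b') : IsParametrizedHom s b Y (g.f ▷ Y.right ≫ h) := by
  have := s.naturality (Under.homMk g.f hg : pointed b ⟶ pointed b') (𝟙 Y)
  simp only [Under.homMk_right, Under.id_right, tensorHom_id] at this
  rw [IsParametrizedHom, ← comp_whiskerRight_assoc, ← g.h, comp_whiskerRight_assoc, hh, H.map_comp,
    Category.assoc, ← Category.assoc, this, Category.assoc]

theorem whiskerLeft_comp {h : B.a ⊗ Y'.right ⟶ T.a} (hh : IsParametrizedHom s b Y' h) (k : Y ⟶ Y') :
    IsParametrizedHom s b Y (B.a ◁ k.right ≫ h) := by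
  have : H.obj B.a ◁ k.right ≫ s.app (pointed b) Y' =
      s.app (pointed b) Y ≫ H.map (B.a ◁ k.right) := by
    simpa using s.naturality (𝟙 (pointed b)) k
  rw [IsParametrizedHom, ← whisker_exchange_assoc, hh, reassoc_of% this, H.map_comp, Category.assoc]

theorem comp {h : B.a ⊗ Y.right ⟶ T.a} (hh : IsParametrizedHom s b Y h) (g : T ⟶ T') :
    IsParametrizedHom s b Y (h ≫ g.f) := by
  rw [IsParametrizedHom, ← Category.assoc, hh, H.map_comp, Category.assoc, Category.assoc,
    Category.assoc, g.h]

theorem rightUnitor (b : 𝟙_ C ⟶ B.a) :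
    IsParametrizedHom s b (pointed (𝟙 (𝟙_ C))) (ρ_ B.a).hom := by
  have : s.app (pointed b) (pointed (𝟙 (𝟙_ C))) ≫ H.map (ρ_ B.a).hom = (ρ_ (H.obj B.a)).hom :=
    s.unit (pointed b)
  rw [IsParametrizedHom, reassoc_of% this]
  exact rightUnitor_naturality _

/-- The tensor axiom of `s` splits the parameter `Y ⊗ Z`. The condition `hc` says that `h` preserves
points, so that `s` is natural along it. -/
theorem tensor {h : B.a ⊗ Y.right ⟶ T.a} (hh : IsParametrizedHom s b Y h) {c : 𝟙_ C ⟶ T.a}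
    (hc : (λ_ (𝟙_ C)).inv ≫ (b ⊗ₘ Y.hom) ≫ h = c) {k : T.a ⊗ Z.right ⟶ T'.a}
    (hk : IsParametrizedHom s c Z k) : IsParametrizedHom s b (pointedTensor Y Z)
      ((α_ B.a Y.right Z.right).inv ≫ h ▷ Z.right ≫ k) := by
  have h₁ := s.naturality (Under.homMk h (by simpa using hc) :
    pointedTensor (pointed b) Y ⟶ pointed c) (𝟙 Z)
  simp only [Under.homMk_right, Under.id_right, tensorHom_id] at h₁
  have h₂ : s.app (pointed b) (pointedTensor Y Z) = (α_ (H.obj B.a) Y.right Z.right).inv ≫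
      s.app (pointed b) Y ▷ Z.right ≫ s.app (pointedTensor (pointed b) Y) Z ≫
        H.map (α_ B.a Y.right Z.right).hom :=
    (Iso.eq_inv_comp _).2 (s.tensor (pointed b) Y Z)
  change B.str ▷ (Y.right ⊗ Z.right) ≫ _ = _
  rw [h₂, associator_inv_naturality_left_assoc, ← comp_whiskerRight_assoc, hh,
    comp_whiskerRight_assoc, comp_whiskerRight_assoc, hk, reassoc_of% h₁]
  simp only [Category.assoc, H.map_comp]
  rw [← H.map_comp_assoc (α_ B.a Y.right Z.right).hom, Iso.hom_inv_id, H.map_id, Category.id_comp]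

end IsParametrizedHom

end ParametrizedHomomorphisms

/-! ### Recursion with a pointed parameter -/

section StrengthSolutions

open Endofunctor

variable {C : Type u} [Category.{v} C] [MonoidalCategory C] [MonoidallyLFP C]

instance (W : C) : PreservesFiniteCoproducts (tensorRight W) :=
  MonoidallyLFP.right_distributive W

instance (P Q W : C) : PreservesColimit (pair P Q) (tensorRight W) := inferInstance

instance : IsLocallyFinitelyPresentable.{v} C := MonoidallyLFP.locallyFinitelyPresentable

variable {H : C ⥤ C} (s : PointStrength H) {A : Algebra H} (hA : IsIterative A)

include hA in
/-- Equations obtained from a finitely presentable pointed coalgebra have unique solutions. -/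
theorem existsUnique_solution_strengthEquation {W : Under (𝟙_ C)}
    (hW : IsFinitelyPresentable.{v} W.right) (Y : Under (𝟙_ C)) {X : C}
    (e : W.right ⟶ H.obj W.right ⨿ X) (f : X ⊗ Y.right ⟶ A.a) :
    ∃! h, IsSolution A (strengthEquation s W Y e f) h := by
  obtain ⟨J, _, _, D, c, hc, hpt, hD⟩ := exists_filtered_presentation Y.right
  obtain ⟨Z, rfl, y, rfl⟩ : ∃ (Z : C) (_ : Z = c.pt) (y : 𝟙_ C ⟶ Z), Y = Under.mk y :=
    ⟨Y.right, hpt.symm, Y.hom, rfl⟩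
  have := MonoidallyLFP.unit_finitelyPresentable (C := C)
  -- The point of `Y` factors through a stage `j₀`; every stage under `j₀` is then pointed
  -- compatibly, and these stages are cofinal.
  obtain ⟨j₀, p, hp⟩ := IsFinitelyPresentable.exists_hom_of_isColimit hc y
  have := MonoidallyLFP.finitary_right_variable W.right
  have := PreservesFilteredColimitsOfSize.preserves_filtered_colimits (F := tensorLeft W.right) J
  have hc' := (Functor.Final.isColimitWhiskerEquiv (Under.forget j₀) _).symm
    (isColimitOfPreserves (tensorLeft W.right) hc)
  let D' (j : Under j₀) : Under (𝟙_ C) := pointed (p ≫ D.map j.hom)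
  let k (j : Under j₀) : D' j ⟶ Under.mk y := Under.homMk (c.ι.app j.right) (by simp [D', hp])
  have hk {i j : Under j₀} (u : i ⟶ j) : (p ≫ D.map i.hom) ≫ D.map u.right = p ≫ D.map j.hom := by
    rw [Category.assoc, ← D.map_comp, Under.w]
  refine existsUnique_solution_of_colimit (D := Under.forget j₀ ⋙ D ⋙ tensorLeft W.right)
    (fun j => W.right ◁ (k j).right) hc'.existsUnique_desc _
    (fun j => strengthEquation s W (D' j) e (X ◁ (k j).right ≫ f)) (fun j => ?_) (fun {i j} u => ?_)
    fun j => hA _ (MonoidallyLFP.tensor_finitelyPresentable _ _ hW (hD j.right)) _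
  · simpa using strengthEquation_naturality s (𝟙 W) (k j) (e := e) (e' := e) (by simp) (f' := f) rfl
  · simpa using strengthEquation_naturality s (𝟙 W) (Under.homMk (D.map u.right) (hk u) : D' i ⟶ D' j)
      (e := e) (e' := e) (by simp) (f' := X ◁ (k j).right ≫ f) (f := X ◁ (k i).right ≫ f)
      (by simp [k, ← whiskerLeft_comp_assoc])

variable [Functor.IsFinitelyAccessible.{v} H]

include hA in
theorem existsUnique_solution_strengthEquation_rationalOut {X : C} (x : 𝟙_ C ⟶ X) (Y : Under (𝟙_ C))
    (f : X ⊗ Y.right ⟶ A.a) :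
    ∃! h, IsSolution A (strengthEquation s (pointed (x ≫ rationalUnit H X)) Y (rationalOut H X) f)
      h := by
  -- The point itself is a one-step coalgebra on `I`, whose injection is the point of the rational
  -- carrier. Coalgebras under `c₀` are thus canonically pointed, and they are cofinal.
  let c₀ : FPCoalgebra (addConst H X) :=
    FPCoalgebra.mk (MonoidallyLFP.unit_finitelyPresentable (C := C)) (x ≫ coprod.inr)
  have hc₀ : c₀.inj = x ≫ rationalUnit H X := by
    rw [← Category.assoc, IsIso.eq_comp_inv, inj_rationalOut]
    change (x ≫ coprod.inr) ≫ coprod.map _ _ = _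
    simp
  have := MonoidallyLFP.finitary_left_variable Y.right
  have : Functor.IsFinitelyAccessible.{v} (tensorRight Y.right) :=
    Functor.isFinitelyAccessible_iff_preservesFilteredColimits.2 this
  have := isCardinalFiltered_fpCoalgebra (addConst H X)
  have := (tensorRight Y.right).preservesColimitsOfShape_of_isCardinalAccessible_of_essentiallySmall
    Cardinal.aleph0.{v} (FPCoalgebra (addConst H X))
  have hc' := (Functor.Final.isColimitWhiskerEquiv (Under.forget c₀) _).symm
    (isColimitOfPreserves (tensorRight Y.right) (isColimitRationalCocone (addConst H X)))
  let D' (c : Under c₀) : Under (𝟙_ C) := pointed (X := c.right.obj.V) c.hom.hom.f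
  refine existsUnique_solution_of_colimit
    (D := Under.forget c₀ ⋙ FPCoalgebra.carrier (addConst H X) ⋙ tensorRight Y.right)
    (fun c => c.right.inj ▷ Y.right) hc'.existsUnique_desc _
    (fun c => strengthEquation s (D' c) Y c.right.obj.str f) (fun c => ?_) (fun {c d} u => ?_)
    fun c => existsUnique_solution_strengthEquation s hA (W := D' c) c.right.property Y _ f
  · exact strengthEquation_naturality_left s (W := D' c) (W' := pointed (x ≫ rationalUnit H X))
      c.right.inj ((FPCoalgebra.w_inj c.hom).trans hc₀) Y (inj_rationalOut c.right).symm f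
  · exact strengthEquation_naturality_left s (W := D' c) (W' := D' d) u.right.hom.f
      (congrArg (fun t => t.hom.f) (Under.w u)) Y u.right.hom.h f

omit [MonoidallyLFP C] [Functor.IsFinitelyAccessible.{v} H] in
-- Any two free iterative algebras on `X` are isomorphic by maps preserving the units, so the
-- property transfers from the colimit construction to an arbitrary choice.
theorem existsUnique_strength_lift_of_free [HasBinaryCoproducts C] {X : C}
    (R₀ R : FreeIterativeAlgebra H X) (x : 𝟙_ C ⟶ X) (Y : Under (𝟙_ C)) (f : X ⊗ Y.right ⟶ A.a)
    (h₀ : ∃! h : R₀.alg.a ⊗ Y.right ⟶ A.a,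
      IsParametrizedHom s (x ≫ R₀.η) Y h ∧ R₀.η ▷ Y.right ≫ h = f) :
    ∃! h : R.alg.a ⊗ Y.right ⟶ A.a,
      IsParametrizedHom s (x ≫ R.η) Y h ∧ R.η ▷ Y.right ≫ h = f := by
  let φ : R.alg ⟶ R₀.alg := R.extend R₀.alg R₀.iterative R₀.η
  let ψ : R₀.alg ⟶ R.alg := R₀.extend R.alg R.iterative R.η
  have hφ : R.η ≫ φ.f = R₀.η := R.η_extend _ _ _
  have hψ : R₀.η ≫ ψ.f = R.η := R₀.η_extend _ _ _
  have hφψ : φ.f ≫ ψ.f = 𝟙 _ := R.hom_ext (g := φ ≫ ψ) (h := 𝟙 R.alg) _ R.iterative (by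
    rw [Algebra.comp_f, ← Category.assoc, hφ, hψ]; exact (Category.comp_id _).symm)
  obtain ⟨h, hh, hh'⟩ := h₀
  refine ⟨φ.f ▷ Y.right ≫ h, ⟨hh.1.whiskerRight_comp φ (by rw [Category.assoc, hφ]), ?_⟩, ?_⟩
  · rw [← comp_whiskerRight_assoc, hφ]
    exact hh.2
  · rintro h' ⟨h₁, h₂⟩
    have := hh' (ψ.f ▷ Y.right ≫ h') ⟨h₁.whiskerRight_comp ψ (by rw [Category.assoc, hψ]), by
      rw [← h₂, ← hψ, comp_whiskerRight, Category.assoc]⟩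
    rw [← this, ← comp_whiskerRight_assoc, hφψ, id_whiskerRight, Category.id_comp]

include hA in
/-- Morphisms out of `R X ⊗ Y` into an iterative algebra can be defined, uniquely, by recursion on
`R X`. -/
theorem existsUnique_strength_lift {X : C} (R : FreeIterativeAlgebra H X) (x : 𝟙_ C ⟶ X)
    (Y : Under (𝟙_ C)) (f : X ⊗ Y.right ⟶ A.a) :
    ∃! h : R.alg.a ⊗ Y.right ⟶ A.a,
      IsParametrizedHom s (x ≫ R.η) Y h ∧ R.η ▷ Y.right ≫ h = f := by
  refine existsUnique_strength_lift_of_free s (rationalFreeIterativeAlgebra H X) R x Y f ?_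
  obtain ⟨h, hh, hh'⟩ := existsUnique_solution_strengthEquation_rationalOut s hA x Y f
  have key (h : rationalCarrier (addConst H X) ⊗ Y.right ⟶ A.a) :=
    isSolution_strengthEquation_iff s (W := pointed (x ≫ rationalUnit H X)) (rationalOut H X) f h
  exact ⟨h, (key h).1 hh, fun h' hh₁ => hh' h' ((key h').2 hh₁)⟩

end StrengthSolutions

/-! ### Functor and multiplication of the rational monad as algebra homomorphisms -/

section RationalHomomorphisms

open Endofunctor

variable {C : Type u} [Category.{v} C] [HasBinaryCoproducts C] {H : C ⥤ C}
  (R : ∀ Y : C, FreeIterativeAlgebra H Y)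

/-- The homomorphism underlying the action of the rational functor. -/
noncomputable abbrev rationalMapHom {X Y : C} (f : X ⟶ Y) : (R X).alg ⟶ (R Y).alg :=
  (R X).extend (R Y).alg (R Y).iterative (f ≫ (R Y).η)

/-- The homomorphism underlying the multiplication of the rational monad. -/
noncomputable abbrev rationalMulHom (Y : C) : (R (R Y).alg.a).alg ⟶ (R Y).alg :=
  (R (R Y).alg.a).extend (R Y).alg (R Y).iterative (𝟙 _)

theorem η_rationalMapHom {X Y : C} (f : X ⟶ Y) :
    (R X).η ≫ (rationalMapHom R f).f = f ≫ (R Y).η :=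
  (R X).η_extend _ _ _

theorem η_rationalMapHom_assoc {X Y Z : C} (f : X ⟶ Y) (h : (R Y).alg.a ⟶ Z) :
    (R X).η ≫ (rationalMapHom R f).f ≫ h = f ≫ (R Y).η ≫ h := by
  rw [← Category.assoc, η_rationalMapHom, Category.assoc]

theorem η_rationalMulHom (Y : C) : (R (R Y).alg.a).η ≫ (rationalMulHom R Y).f = 𝟙 _ :=
  (R (R Y).alg.a).η_extend _ _ _

end RationalHomomorphisms

/-! ### The point-strength of the rational monad and the `H`-monoid on `I` -/

section RationalStrength

open Endofunctor

variable {C : Type u} [Category.{v} C] [MonoidalCategory C] [MonoidallyLFP C] {H : C ⥤ C}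
  [Functor.IsFinitelyAccessible.{v} H] (s : PointStrength H) (R : ∀ Y : C, FreeIterativeAlgebra H Y)

section

variable {s} {X Y : Under (𝟙_ C)} {A : Algebra H}

theorem parametrizedHom_ext (hA : IsIterative A) {h h' : (R X.right).alg.a ⊗ Y.right ⟶ A.a}
    (hh : IsParametrizedHom s (X.hom ≫ (R X.right).η) Y h)
    (hh' : IsParametrizedHom s (X.hom ≫ (R X.right).η) Y h')
    (w : (R X.right).η ▷ Y.right ≫ h = (R X.right).η ▷ Y.right ≫ h') : h = h' :=
  (existsUnique_strength_lift s hA (R X.right) X.hom Y _).unique ⟨hh, w⟩ ⟨hh', rfl⟩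

end

/-- The components of the point-strength of the rational monad. -/
noncomputable def rationalStrengthApp (X Y : Under (𝟙_ C)) :
    (R X.right).alg.a ⊗ Y.right ⟶ (R (X.right ⊗ Y.right)).alg.a :=
  (existsUnique_strength_lift s (R (X.right ⊗ Y.right)).iterative (R X.right) X.hom Y
    (R (X.right ⊗ Y.right)).η).choose

theorem isParametrizedHom_rationalStrengthApp (X Y : Under (𝟙_ C)) :
    IsParametrizedHom s (T := (R (X.right ⊗ Y.right)).alg) (X.hom ≫ (R X.right).η) Y
      (rationalStrengthApp s R X Y) :=
  (existsUnique_strength_lift s (R (X.right ⊗ Y.right)).iterative (R X.right) X.hom Y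
    (R (X.right ⊗ Y.right)).η).choose_spec.1.1

theorem η_rationalStrengthApp (X Y : Under (𝟙_ C)) :
    (R X.right).η ▷ Y.right ≫ rationalStrengthApp s R X Y = (R (X.right ⊗ Y.right)).η :=
  (existsUnique_strength_lift s (R (X.right ⊗ Y.right)).iterative (R X.right) X.hom Y
    (R (X.right ⊗ Y.right)).η).choose_spec.1.2

theorem η_rationalStrengthApp_assoc (X Y : Under (𝟙_ C)) {Z : C}
    (h : (R (X.right ⊗ Y.right)).alg.a ⟶ Z) :
    (R X.right).η ▷ Y.right ≫ rationalStrengthApp s R X Y ≫ h = (R (X.right ⊗ Y.right)).η ≫ h := by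
  rw [← Category.assoc, η_rationalStrengthApp]

theorem rationalStrengthApp_naturality {X X' Y Y' : Under (𝟙_ C)} (f : X ⟶ X') (g : Y ⟶ Y') :
    ((rationalMapHom R f.right).f ⊗ₘ g.right) ≫ rationalStrengthApp s R X' Y' =
      rationalStrengthApp s R X Y ≫ (rationalMapHom R (f.right ⊗ₘ g.right)).f := by
  rw [MonoidalCategory.tensorHom_def, Category.assoc]
  refine parametrizedHom_ext R (s := s) (R _).iterative (IsParametrizedHom.whiskerRight_comp
    ((isParametrizedHom_rationalStrengthApp s R X' Y').whiskerLeft_comp g) (rationalMapHom R f.right)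
    ?_) ((isParametrizedHom_rationalStrengthApp s R X Y).comp _) ?_
  · rw [Category.assoc, η_rationalMapHom, ← Category.assoc, Under.w]
  · rw [← comp_whiskerRight_assoc, η_rationalMapHom, comp_whiskerRight_assoc,
      ← whisker_exchange_assoc, η_rationalStrengthApp, η_rationalStrengthApp_assoc,
      η_rationalMapHom, ← MonoidalCategory.tensorHom_def_assoc]

theorem rationalStrengthApp_rightUnitor (X : Under (𝟙_ C)) :
    rationalStrengthApp s R X (pointed (𝟙 (𝟙_ C))) ≫ (rationalMapHom R (ρ_ X.right).hom).f =
      (ρ_ (R X.right).alg.a).hom := by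
  refine parametrizedHom_ext R (R X.right).iterative
    ((isParametrizedHom_rationalStrengthApp s R X _).comp _) (IsParametrizedHom.rightUnitor _) ?_
  rw [η_rationalStrengthApp_assoc, η_rationalMapHom]
  exact (rightUnitor_naturality _).symm

theorem rationalStrengthApp_tensor (X Y Z : Under (𝟙_ C)) :
    rationalStrengthApp s R X (pointedTensor Y Z) =
      (α_ (R X.right).alg.a Y.right Z.right).inv ≫ rationalStrengthApp s R X Y ▷ Z.right ≫
        rationalStrengthApp s R (pointedTensor X Y) Z ≫
          (rationalMapHom R (α_ X.right Y.right Z.right).hom).f := by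
  refine parametrizedHom_ext R (R _).iterative (isParametrizedHom_rationalStrengthApp s R X _)
    ((isParametrizedHom_rationalStrengthApp s R X Y).tensor ?_
      ((isParametrizedHom_rationalStrengthApp s R (pointedTensor X Y) Z).comp
        (rationalMapHom R (α_ X.right Y.right Z.right).hom))) ?_
  -- The strength carries the tensor of the points of `R X` and `Y` to the point of `R (X ⊗ Y)`, as
  -- chaining the two recursions requires.
  · rw [tensorHom_def', comp_whiskerRight, Category.assoc, Category.assoc, η_rationalStrengthApp]
    change _ = ((λ_ (𝟙_ C)).inv ≫ (X.hom ⊗ₘ Y.hom)) ≫ _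
    rw [tensorHom_def' X.hom Y.hom, Category.assoc, Category.assoc]
    rfl
  · rw [η_rationalStrengthApp]
    change _ = (R X.right).η ▷ (Y.right ⊗ Z.right) ≫ _
    rw [associator_inv_naturality_left_assoc, ← comp_whiskerRight_assoc, η_rationalStrengthApp]
    have h := η_rationalStrengthApp_assoc s R (pointedTensor X Y) Z
      (rationalMapHom R (α_ X.right Y.right Z.right).hom).f
    refine .trans ?_ (congrArg ((α_ X.right Y.right Z.right).inv ≫ ·) h.symm)
    have h' := η_rationalMapHom R (α_ X.right Y.right Z.right).hom
    refine .trans ?_ (congrArg ((α_ X.right Y.right Z.right).inv ≫ ·) h'.symm)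
    exact (Iso.inv_hom_id_assoc _ _).symm

theorem rationalStrengthApp_mul (X Y : Under (𝟙_ C)) :
    (rationalMulHom R X.right).f ▷ Y.right ≫ rationalStrengthApp s R X Y =
      rationalStrengthApp s R (pointed (X.hom ≫ (R X.right).η)) Y ≫
        (rationalMapHom R (rationalStrengthApp s R X Y) ≫ rationalMulHom R (X.right ⊗ Y.right)).f := by
  refine parametrizedHom_ext R (X := pointed (X.hom ≫ (R X.right).η)) (R _).iterative
    ((isParametrizedHom_rationalStrengthApp s R X Y).whiskerRight_comp (rationalMulHom R X.right) ?_)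
    ((isParametrizedHom_rationalStrengthApp s R _ Y).comp _) ?_
  · rw [Category.assoc]
    exact (congrArg (_ ≫ ·) (η_rationalMulHom R X.right)).trans (Category.comp_id _)
  · change (R (R X.right).alg.a).η ▷ Y.right ≫ _ = _
    rw [← comp_whiskerRight_assoc, η_rationalMulHom, id_whiskerRight, Category.id_comp]
    refine Eq.trans ?_ (η_rationalStrengthApp_assoc s R (pointed (X.hom ≫ (R X.right).η)) Y
      _).symm
    rw [Algebra.comp_f]
    refine Eq.trans ?_ (η_rationalMapHom_assoc R (rationalStrengthApp s R X Y) _).symm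
    rw [η_rationalMulHom, Category.comp_id]

/-- The point-strength of the rational monad. -/
noncomputable def rationalStrength : PointStrength (rationalFunctor R) where
  app := rationalStrengthApp s R
  naturality f g := rationalStrengthApp_naturality s R f g
  unit X := rationalStrengthApp_rightUnitor s R X
  tensor X Y Z := (Iso.eq_inv_comp _).1 (rationalStrengthApp_tensor s R X Y Z)

theorem isRationalStrength_rationalStrength :
    IsRationalStrength s R (rationalStrength s R).toPointedFamily where
  str X Y := isParametrizedHom_rationalStrengthApp s R X Y
  η X Y := η_rationalStrengthApp s R X Y

theorem eq_rationalStrength (t : PointedFamily (rationalFunctor R))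
    (ht : IsRationalStrength s R t) : t = (rationalStrength s R).toPointedFamily := by
  obtain ⟨app, nat⟩ := t
  have : app = rationalStrengthApp s R := by
    funext X Y
    exact parametrizedHom_ext R (R _).iterative (ht.str X Y)
      (isParametrizedHom_rationalStrengthApp s R X Y)
      ((ht.η X Y).trans (η_rationalStrengthApp s R X Y).symm)
  subst this
  rfl

theorem isPointStrongMonad_rationalStrength :
    IsPointStrongMonad (rationalMonad R) (rationalStrength s R) where
  unit X Y := η_rationalStrengthApp s R X Y
  mul X Y := rationalStrengthApp_mul s R X Y

/-- The multiplication of the `H`-monoid `R I`. -/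
noncomputable def rationalMonoidMul :
    (R (𝟙_ C)).alg.a ⊗ (R (𝟙_ C)).alg.a ⟶ (R (𝟙_ C)).alg.a :=
  rationalStrengthApp s R (pointed (𝟙 (𝟙_ C))) (pointed (R (𝟙_ C)).η) ≫
    (rationalMapHom R (λ_ (R (𝟙_ C)).alg.a).hom ≫ rationalMulHom R (𝟙_ C)).f

/-- This is already the `H`-monoid law, and it also drives the uniqueness proofs of the monoid
axioms. -/
theorem isParametrizedHom_rationalMonoidMul :
    IsParametrizedHom s (B := (R (𝟙_ C)).alg) (T := (R (𝟙_ C)).alg) (R (𝟙_ C)).η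
      (pointed (R (𝟙_ C)).η) (rationalMonoidMul s R) := by
  have h : IsParametrizedHom s (B := (R (𝟙_ C)).alg) (T := (R (𝟙_ C)).alg)
      (𝟙 (𝟙_ C) ≫ (R (𝟙_ C)).η) (pointed (R (𝟙_ C)).η) (rationalMonoidMul s R) :=
    (isParametrizedHom_rationalStrengthApp s R (pointed (𝟙 (𝟙_ C))) (pointed (R (𝟙_ C)).η)).comp
      (rationalMapHom R (λ_ (R (𝟙_ C)).alg.a).hom ≫ rationalMulHom R (𝟙_ C))
  rwa [Category.id_comp] at h

theorem η_rationalMonoidMul :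
    (R (𝟙_ C)).η ▷ (R (𝟙_ C)).alg.a ≫ rationalMonoidMul s R = (λ_ (R (𝟙_ C)).alg.a).hom := by
  have := η_rationalStrengthApp_assoc s R (pointed (𝟙 (𝟙_ C))) (pointed (R (𝟙_ C)).η)
    (rationalMapHom R (λ_ (R (𝟙_ C)).alg.a).hom ≫ rationalMulHom R (𝟙_ C)).f
  refine this.trans ?_
  rw [Algebra.comp_f]
  exact (η_rationalMapHom_assoc R (λ_ (R (𝟙_ C)).alg.a).hom _).trans (by
    rw [η_rationalMulHom, Category.comp_id])

theorem parametrizedHom_ext_unit {s : PointStrength H} {A : Algebra H} (hA : IsIterative A)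
    {Y : Under (𝟙_ C)} {h h' : (R (𝟙_ C)).alg.a ⊗ Y.right ⟶ A.a}
    (hh : IsParametrizedHom s (R (𝟙_ C)).η Y h) (hh' : IsParametrizedHom s (R (𝟙_ C)).η Y h')
    (w : (R (𝟙_ C)).η ▷ Y.right ≫ h = (R (𝟙_ C)).η ▷ Y.right ≫ h') : h = h' := by
  rw [← Category.id_comp (R (𝟙_ C)).η] at hh hh'
  exact parametrizedHom_ext R (X := pointed (𝟙 (𝟙_ C))) hA hh hh' w

theorem point_rationalMonoidMul : (λ_ (𝟙_ C)).inv ≫ ((R (𝟙_ C)).η ⊗ₘ (R (𝟙_ C)).η) ≫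
    rationalMonoidMul s R = (R (𝟙_ C)).η := by
  rw [tensorHom_def', Category.assoc, η_rationalMonoidMul, leftUnitor_naturality,
    Iso.inv_hom_id_assoc]

/-- The monoid structure of `R I`. -/
noncomputable abbrev rationalMonObj : MonObj (R (𝟙_ C)).alg.a where
  one := (R (𝟙_ C)).η
  mul := rationalMonoidMul s R
  one_mul := η_rationalMonoidMul s R
  mul_one := by
    -- The unit is a morphism of pointed objects from `I` to `R I`, so the multiplication may be
    -- restricted along it in the parameter.
    refine parametrizedHom_ext_unit R (s := s) (Y := pointed (𝟙 (𝟙_ C))) (R (𝟙_ C)).iterative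
      ((isParametrizedHom_rationalMonoidMul s R).whiskerLeft_comp
        (Under.homMk (R (𝟙_ C)).η : pointed (𝟙 (𝟙_ C)) ⟶ pointed (R (𝟙_ C)).η))
      (IsParametrizedHom.rightUnitor _) ?_
    change (R (𝟙_ C)).η ▷ 𝟙_ C ≫ (R (𝟙_ C)).alg.a ◁ (R (𝟙_ C)).η ≫ _ = (R (𝟙_ C)).η ▷ 𝟙_ C ≫ _
    rw [← whisker_exchange_assoc, η_rationalMonoidMul, leftUnitor_naturality,
      rightUnitor_naturality, unitors_equal]
  mul_assoc := by
    rw [← Iso.inv_comp_eq]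
    have h := isParametrizedHom_rationalMonoidMul s R
    -- The multiplication preserves points, so it can serve as a change of parameter on one side of
    -- associativity and as the first recursion on the other.
    let k : pointedTensor (pointed (R (𝟙_ C)).η) (pointed (R (𝟙_ C)).η) ⟶ pointed (R (𝟙_ C)).η :=
      Under.homMk (rationalMonoidMul s R)
        ((Category.assoc _ _ _).trans (point_rationalMonoidMul s R))
    refine parametrizedHom_ext_unit R (s := s)
      (Y := pointedTensor (pointed (R (𝟙_ C)).η) (pointed (R (𝟙_ C)).η)) (R (𝟙_ C)).iterative
      (h.tensor (point_rationalMonoidMul s R) h)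
      (h.whiskerLeft_comp k) ?_
    · change (R (𝟙_ C)).η ▷ ((R (𝟙_ C)).alg.a ⊗ (R (𝟙_ C)).alg.a) ≫ _ =
        (R (𝟙_ C)).η ▷ ((R (𝟙_ C)).alg.a ⊗ (R (𝟙_ C)).alg.a) ≫
          (R (𝟙_ C)).alg.a ◁ rationalMonoidMul s R ≫ rationalMonoidMul s R
      rw [← whisker_exchange_assoc, η_rationalMonoidMul, leftUnitor_naturality]
      rw [associator_inv_naturality_left_assoc, ← comp_whiskerRight_assoc, η_rationalMonoidMul,
        leftUnitor_tensor_hom, Category.assoc]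

end RationalStrength

theorem corollary3p12 {C : Type u} [Category.{v} C] [MonoidalCategory C] [MonoidallyLFP C]
    (H : C ⥤ C) (hH : PreservesFilteredColimits H) (sH : PointStrength H) :
    (∀ Y : C, Nonempty (FreeIterativeAlgebra H Y)) ∧
    ∀ R : (∀ Y : C, FreeIterativeAlgebra H Y),
      ∃ sR : PointStrength (rationalMonad R).toFunctor,
        IsRationalStrength sH R sR.toPointedFamily ∧
        (∀ t : PointedFamily (rationalFunctor R), IsRationalStrength sH R t →
          t = sR.toPointedFamily) ∧
        IsPointStrongMonad (rationalMonad R) sR ∧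
        ∃ M : MonObj (R (𝟙_ C)).alg.a,
          M.one = (R (𝟙_ C)).η ∧
          M.mul =
            sR.app (pointed (𝟙 (𝟙_ C))) (pointed (R (𝟙_ C)).η) ≫
              (rationalMonad R).map (λ_ (R (𝟙_ C)).alg.a).hom ≫
              (rationalMonad R).μ.app (𝟙_ C) ∧
          IsHMonoid sH (R (𝟙_ C)).alg M := by
  have : Functor.IsFinitelyAccessible.{v} H :=
    Functor.isFinitelyAccessible_iff_preservesFilteredColimits.2 hH
  exact ⟨fun Y => ⟨rationalFreeIterativeAlgebra H Y⟩, fun R => ⟨rationalStrength sH R,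
    isRationalStrength_rationalStrength sH R, eq_rationalStrength sH R,
    isPointStrongMonad_rationalStrength sH R, rationalMonObj sH R, rfl, rfl,
    isParametrizedHom_rationalMonoidMul sH R⟩⟩
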